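/- For $\nu\in\mathbb{C}$ and $t\in\mathbb{C}\setminus\{0\}$ let $$I_\nu(t)=\Big(\frac t2\Big)^{\nu}\sum_{k=0}^{\infty}\frac{(t^2/4)^k}{k!\,\Gamma(\nu+k+1)}$$ be the modified Bessel function of the first kind, where $(t/2)^\nu$ has its principal value ($-\pi<\arg t\le\pi$) and $1/\Gamma$ is $0$ at the poles of $\Gamma$. Let $K_\nu(t)$ be the modified Bessel function of the second kind, that is, $K_\nu(t)=\frac{\pi}{2}\,\frac{I_{-\nu}(t)-I_\nu(t)}{\sin(\pi\nu)}$ for $\nu\notin\mathbb{Z}$, and $K_n(t)=\lim_{\nu\to n}K_\nu(t)$ for $n\in\mathbb{Z}$. Then for every integer $m\ge 0$ and every $t\in\mathbb{C}\setminus\{0\}$ the function $\nu\mapsto I_\nu(t)$ is (complex) differentiable at $\nu=m$ and at $\nu=-m$, and $$\left.\frac{\partial I_\nu(t)}{\partial\nu}\right|_{\nu=\pm m}=(-1)^m\left[-K_m(t)\pm\frac{m!}{2}\sum_{k=0}^{m-1}\frac{(-1)^k I_k(t)}{k!\,(m-k)}\Big(\frac t2\Big)^{k-m}\right],$$ where the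 same sign is taken on both sides. -/

import Mathlib

open Filter Topology

/-- The modified Bessel function of the first kind,
`I_ν(t) = (t/2)^ν ∑_{k ≥ 0} (t^2/4)^k / (k! Γ(ν + k + 1))`, for complex order `ν` and complex
argument `t`, with the principal value of `(t/2)^ν` (`-π < arg t ≤ π`).  As usual `1/Γ` is taken
to be `0` at the poles of `Γ`, which is what Mathlib's `(Complex.Gamma s)⁻¹` gives. -/
noncomputable def modifiedBesselI (ν t : ℂ) : ℂ :=
  (t / 2) ^ ν * ∑' k : ℕ, (t ^ 2 / 4) ^ k / (k.factorial : ℂ) * (Complex.Gamma (ν + k + 1))⁻¹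

/-- The quotient `(π/2) (I_{-ν}(t) - I_ν(t)) / sin(πν)`, meaningful for non-integral `ν`. -/
noncomputable def modifiedBesselKQuot (ν t : ℂ) : ℂ :=
  (Real.pi : ℂ) / 2 * (modifiedBesselI (-ν) t - modifiedBesselI ν t) /
    Complex.sin ((Real.pi : ℂ) * ν)

open Classical in
/-- The modified Bessel function of the second kind (Macdonald function): `K_ν(t)` is
`(π/2) (I_{-ν}(t) - I_ν(t)) / sin(πν)` if `ν` is not an integer, and for integral `ν` it is the
limit of this expression as the order tends to `ν` (for `t ≠ 0` this limit exists). -/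
noncomputable def modifiedBesselK (ν t : ℂ) : ℂ :=
  if ∃ n : ℤ, ν = n then limUnder (𝓝[≠] ν) (fun μ : ℂ => modifiedBesselKQuot μ t)
  else modifiedBesselKQuot ν t

namespace ModifiedBessel

/-! Write A and B for the derivatives of I_ν(t) in ν at m and -m; they exist because the series is
entire in ν. Their sum comes from K_m: since I_{-m} = I_m, the quotient defining K is 0/0 at m, and
l'Hôpital gives A + B = -2(-1)^m K_m (`modifiedBesselK_nat`). Their difference comes from a
recurrence in m: differentiating I_{ν-1} - I_{ν+1} = (2ν/t) I_ν at ν = ±(m+1) shows that (-1)^m (A -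
B) satisfies an inhomogeneous second-order recurrence, and m! times the finite sum satisfies the
same one (`orderSum_recurrence`), with the same values at m = 0, 1. Half the sum plus or minus half
the difference is the formula. -/

/-- The functions `ν ↦ 1 / Γ(ν + k + 1)`, `k = 0, 1, 2, …`, are uniformly bounded on each ball. -/
lemma exists_norm_inv_Gamma_add_nat_le (R : ℝ) :
    ∃ C : ℝ, ∀ k : ℕ, ∀ ν ∈ Metric.closedBall (0 : ℂ) R,
      ‖(Complex.Gamma (ν + k + 1))⁻¹‖ ≤ C := by
  have hb : ∀ k : ℕ, ∃ C : ℝ, ∀ ν ∈ Metric.closedBall (0 : ℂ) R,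
      ‖(Complex.Gamma (ν + k + 1))⁻¹‖ ≤ C := fun k =>
    (isCompact_closedBall (0 : ℂ) R).exists_bound_of_continuousOn
      (Complex.differentiable_one_div_Gamma.continuous.comp
        (by fun_prop : Continuous fun ν : ℂ => ν + k + 1)).continuousOn
  choose C hC using hb
  obtain ⟨N, hN⟩ := exists_nat_ge R
  refine ⟨∑ j ∈ Finset.range (N + 1), |C j|, fun k ν hν => ?_⟩
  have hle : ∀ j ∈ Finset.range (N + 1), |C j| ≤ ∑ i ∈ Finset.range (N + 1), |C i| :=
    fun j hj => Finset.single_le_sum (f := fun i => |C i|) (fun i _ => abs_nonneg _) hj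
  rcases le_total k N with hk | hk
  · exact ((hC k ν hν).trans (le_abs_self _)).trans (hle k (by simp; omega))
  -- For k ≥ N ≥ R the factor s = ν + k + 1 in 1/Γ(s) = s/Γ(s+1) has norm at least 1, so the norms
  -- do not increase with k.
  · induction k, hk using Nat.le_induction with
    | base => exact ((hC N ν hν).trans (le_abs_self _)).trans (hle N (by simp))
    | succ k hk ih =>
      refine le_trans ?_ ih
      have hν' : ‖ν‖ ≤ R := by simpa using hν
      have h1 : 1 ≤ ‖ν + k + 1‖ := by
        have h2 : ‖((k + 1 : ℕ) : ℂ)‖ ≤ ‖ν + k + 1‖ + ‖ν‖ := by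
          calc ‖((k + 1 : ℕ) : ℂ)‖ = ‖(ν + k + 1) - ν‖ := by congr 1; push_cast; ring
            _ ≤ _ := norm_sub_le _ _
        rw [Complex.norm_natCast] at h2
        have h3 : (N : ℝ) ≤ k := by exact_mod_cast hk
        push_cast at h2
        linarith
      rw [Complex.one_div_Gamma_eq_self_mul_one_div_Gamma_add_one (ν + k + 1), norm_mul]
      push_cast
      rw [← add_assoc ν]
      exact le_mul_of_one_le_left (norm_nonneg _) h1

/-- The series in `I_ν(t)`, in the variable `w = t² / 4`, converges. -/
lemma summable_term (ν w : ℂ) :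
    Summable fun k : ℕ => w ^ k / (k.factorial : ℂ) * (Complex.Gamma (ν + k + 1))⁻¹ := by
  obtain ⟨C, hC⟩ := exists_norm_inv_Gamma_add_nat_le ‖ν‖
  refine Summable.of_norm_bounded ((Real.summable_pow_div_factorial ‖w‖).mul_right C) fun k => ?_
  rw [norm_mul, norm_div, norm_pow, Complex.norm_natCast]
  exact mul_le_mul_of_nonneg_left (hC k ν (by simp)) (by positivity)

/-- 1/Γ is entire and the terms are dominated by C‖w‖^k/k! on each ball, so the Weierstrass M-test
applies. -/
lemma differentiable_tsum (w : ℂ) :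
    Differentiable ℂ fun ν : ℂ =>
      ∑' k : ℕ, w ^ k / (k.factorial : ℂ) * (Complex.Gamma (ν + k + 1))⁻¹ := by
  intro ν
  obtain ⟨C, hC⟩ := exists_norm_inv_Gamma_add_nat_le (‖ν‖ + 1)
  refine (Complex.differentiableOn_tsum_of_summable_norm (U := Metric.ball 0 (‖ν‖ + 1))
    ((Real.summable_pow_div_factorial ‖w‖).mul_right C) (fun k => ?_) Metric.isOpen_ball
    fun k μ hμ => ?_).differentiableAt (Metric.isOpen_ball.mem_nhds (by simp))
  · exact ((Complex.differentiable_one_div_Gamma.comp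
      (by fun_prop : Differentiable ℂ fun ν : ℂ => ν + k + 1)).const_mul _).differentiableOn
  · rw [norm_mul, norm_div, norm_pow, Complex.norm_natCast]
    exact mul_le_mul_of_nonneg_left (hC k μ (Metric.ball_subset_closedBall hμ)) (by positivity)

lemma differentiable_modifiedBesselI {t : ℂ} (ht : t ≠ 0) :
    Differentiable ℂ fun ν : ℂ => modifiedBesselI ν t := by
  have h2 : t / 2 ≠ 0 := div_ne_zero ht two_ne_zero
  unfold modifiedBesselI
  exact fun ν => (differentiableAt_id.const_cpow (Or.inl h2)).mul (differentiable_tsum _ ν)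

/-- The recurrence `I_{ν-1}(t) - I_{ν+1}(t) = (2 ν / t) I_ν(t)`. -/
lemma modifiedBesselI_sub_modifiedBesselI (ν : ℂ) {t : ℂ} (ht : t ≠ 0) :
    modifiedBesselI (ν - 1) t - modifiedBesselI (ν + 1) t =
      ν / (t / 2) * modifiedBesselI ν t := by
  have h2 : t / 2 ≠ 0 := div_ne_zero ht two_ne_zero
  have hw : t ^ 2 / 4 = (t / 2) ^ 2 := by ring
  unfold modifiedBesselI
  rw [hw]
  generalize t / 2 = z at *
  rw [Complex.cpow_sub _ _ h2, Complex.cpow_add _ _ h2, Complex.cpow_one]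
  have hs := summable_term ν (z ^ 2)
  have hs1 := summable_term (ν + 1) (z ^ 2)
  have hs2 := summable_term (ν - 1) (z ^ 2)
  -- In the term k + 1 on the left, 1/Γ(s) = s/Γ(s+1) with s = ν + (k + 1): the part ν gives the
  -- last series, and (k+1)/(k+1)! = 1/k! gives the shifted one.
  have key : ∑' k : ℕ, (z ^ 2) ^ k / (k.factorial : ℂ) * (Complex.Gamma (ν - 1 + k + 1))⁻¹ =
      z ^ 2 * (∑' k : ℕ, (z ^ 2) ^ k / (k.factorial : ℂ) * (Complex.Gamma (ν + 1 + k + 1))⁻¹) +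
      ν * ∑' k : ℕ, (z ^ 2) ^ k / (k.factorial : ℂ) * (Complex.Gamma (ν + k + 1))⁻¹ := by
    rw [hs2.tsum_eq_zero_add, hs.tsum_eq_zero_add, mul_add, ← tsum_mul_left, ← tsum_mul_left,
      add_left_comm, ← Summable.tsum_add (hs1.mul_left _)
        (((summable_nat_add_iff 1).2 hs).mul_left _)]
    congr 1
    · rw [Complex.one_div_Gamma_eq_self_mul_one_div_Gamma_add_one (ν - 1 + (0 : ℕ) + 1)]
      push_cast
      ring_nf
    · refine tsum_congr fun k => ?_
      have e1 : ν - 1 + ((k + 1 : ℕ) : ℂ) + 1 = ν + (k + 1) := by push_cast; ring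
      have e2 : ν + ((k + 1 : ℕ) : ℂ) + 1 = ν + (k + 1) + 1 := by push_cast; ring
      have e3 : ν + 1 + (k : ℂ) + 1 = ν + (k + 1) + 1 := by ring
      rw [e1, e2, e3, Complex.one_div_Gamma_eq_self_mul_one_div_Gamma_add_one (ν + (k + 1)),
        Nat.factorial_succ]
      have hk : (k : ℂ) + 1 ≠ 0 := by exact_mod_cast k.succ_ne_zero
      have hf : (k.factorial : ℂ) ≠ 0 := by exact_mod_cast k.factorial_ne_zero
      push_cast
      field_simp
      ring
  rw [key]
  field_simp
  ring

/-- The recurrence is symmetric under ν ↦ -ν, and at ν = 0 it gives I_{-1} = I_1. -/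
lemma modifiedBesselI_neg_nat (m : ℕ) {t : ℂ} (ht : t ≠ 0) :
    modifiedBesselI (-(m : ℂ)) t = modifiedBesselI (m : ℂ) t := by
  induction m using Nat.twoStepInduction with
  | zero => simp
  | one =>
    have h := modifiedBesselI_sub_modifiedBesselI 0 ht
    simpa [sub_eq_zero] using h
  | more n ih0 ih1 =>
    have h := modifiedBesselI_sub_modifiedBesselI ((n : ℂ) + 1) ht
    have h' := modifiedBesselI_sub_modifiedBesselI (-((n : ℂ) + 1)) ht
    push_cast at ih1 ⊢
    rw [show (n : ℂ) + 1 - 1 = n by ring, show (n : ℂ) + 1 + 1 = n + 2 by ring] at h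
    rw [show -((n : ℂ) + 1) - 1 = -(n + 2) by ring, show -((n : ℂ) + 1) + 1 = -n by ring,
      ih1, ih0] at h'
    linear_combination h' + h

/-- The recurrence for `∂I_ν(t)/∂ν` obtained by differentiating the one for `I_ν(t)`. -/
lemma deriv_modifiedBesselI_sub (ν : ℂ) {t : ℂ} (ht : t ≠ 0) :
    deriv (fun μ => modifiedBesselI μ t) (ν - 1) - deriv (fun μ => modifiedBesselI μ t) (ν + 1) =
      1 / (t / 2) * modifiedBesselI ν t +
        ν / (t / 2) * deriv (fun μ => modifiedBesselI μ t) ν := by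
  have hd := differentiable_modifiedBesselI ht
  have hl := ((hd (ν - 1)).hasDerivAt.comp_sub_const ν 1).sub
    ((hd (ν + 1)).hasDerivAt.comp_add_const ν 1)
  have hr := ((hasDerivAt_id ν).div_const (t / 2)).mul (hd ν).hasDerivAt
  refine hl.unique (hr.congr_of_eventuallyEq (Eventually.of_forall fun μ => ?_))
  exact modifiedBesselI_sub_modifiedBesselI μ ht

/-! ### Recurrence for the finite sum -/

/-- Partial sums of the defect of the recurrence satisfied by the sums
`m! ∑_{k < m} (-1)^k J_k z^{k-m} / (k! (m-k))`, for a sequence `J` that satisfies the recurrence of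
the modified Bessel functions. -/
lemma sum_range_defect {J : ℕ → ℂ} {z : ℂ} (hz : z ≠ 0)
    (hJ : ∀ k : ℕ, J k - J (k + 2) = (k + 1) / z * J (k + 1)) (n N : ℕ) (hN : N + 1 ≤ n) :
    ∑ k ∈ Finset.range (N + 1), (-1 : ℂ) ^ k * J k / k.factorial * z ^ k *
        (((n + 2) * (n + 1)) / ((n + 2 - k) * z ^ (n + 2)) - 1 / ((n - k) * z ^ n) -
          (n + 1) * (n + 1) / ((n + 1 - k) * z ^ (n + 2))) =
      (-1) ^ N * N / (N.factorial * (n + 1 - N)) * J (N + 1) * z ^ N / z ^ (n + 1) -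
        (-1) ^ N / (N.factorial * (n - N)) * J N * z ^ N / z ^ n := by
  induction N with
  | zero =>
    have h0 : (n : ℂ) ≠ 0 := by exact_mod_cast (by omega : n ≠ 0)
    have h1 : (n : ℂ) + 1 ≠ 0 := by exact_mod_cast (by omega : n + 1 ≠ 0)
    have h2 : (n : ℂ) + 2 ≠ 0 := by exact_mod_cast (by omega : n + 2 ≠ 0)
    simp
    field_simp
    ring
  | succ N ih =>
    rw [Finset.sum_range_succ, ih (by omega)]
    obtain ⟨p, rfl⟩ := Nat.exists_eq_add_of_le hN
    -- Eliminating J (N + 2) leaves an identity linear in J N and J (N + 1), with rational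
    -- coefficients.
    have hp : J (N + 2) = J N - (N + 1) / z * J (N + 1) := by linear_combination -hJ N
    have h0 : (p : ℂ) + 1 ≠ 0 := by exact_mod_cast (by omega : p + 1 ≠ 0)
    have h1 : (p : ℂ) + 2 ≠ 0 := by exact_mod_cast (by omega : p + 2 ≠ 0)
    have h2 : (p : ℂ) + 3 ≠ 0 := by exact_mod_cast (by omega : p + 3 ≠ 0)
    have hk : (N : ℂ) + 1 ≠ 0 := by exact_mod_cast N.succ_ne_zero
    have hf : (N.factorial : ℂ) ≠ 0 := by exact_mod_cast N.factorial_ne_zero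
    rw [show N + 1 + 1 = N + 2 from rfl, hp, Nat.factorial_succ]
    push_cast
    rw [show (N : ℂ) + 2 + p + 2 - (N + 1) = p + 3 by ring,
      show (N : ℂ) + 2 + p - (N + 1) = p + 1 by ring,
      show (N : ℂ) + 2 + p + 1 - (N + 1) = p + 2 by ring,
      show (N : ℂ) + 2 + p + 1 - N = p + 3 by ring,
      show (N : ℂ) + 2 + p - N = p + 2 by ring]
    field_simp
    ring

/-- The finite sum in the formula for `∂I_ν(t)/∂ν` at integers, for a general sequence `J`. -/
noncomputable def orderSum (J : ℕ → ℂ) (z : ℂ) (m : ℕ) : ℂ :=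
  ∑ k ∈ Finset.range m, (-1 : ℂ) ^ k * J k / ((k.factorial : ℂ) * ((m : ℂ) - (k : ℂ))) *
    z ^ ((k : ℤ) - (m : ℤ))

/-- For n = N + 1 the three sums share the indices k ≤ N, where `sum_range_defect` leaves only
boundary terms; these cancel against the top terms k = N + 1, N + 2 and the inhomogeneous term. -/
lemma orderSum_recurrence {J : ℕ → ℂ} {z : ℂ} (hz : z ≠ 0)
    (hJ : ∀ k : ℕ, J k - J (k + 2) = (k + 1) / z * J (k + 1)) (n : ℕ) :
    ((n + 2).factorial : ℂ) * orderSum J z (n + 2) =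
      n.factorial * orderSum J z n + (n + 1) / z * ((n + 1).factorial * orderSum J z (n + 1)) -
        (-1) ^ n * (2 / z) * J (n + 1) := by
  have hzp : ∀ k m : ℕ, z ^ ((k : ℤ) - (m : ℤ)) = z ^ k / z ^ m := fun k m => by
    rw [zpow_sub₀ hz, zpow_natCast, zpow_natCast]
  simp only [orderSum, hzp]
  rcases n with _ | N
  · simp [Finset.sum_range_succ]
    field_simp
    ring
  have h := sum_range_defect hz hJ (N + 1) N le_rfl
  have hf : (N.factorial : ℂ) ≠ 0 := by exact_mod_cast N.factorial_ne_zero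
  have hk : (N : ℂ) + 1 ≠ 0 := by exact_mod_cast N.succ_ne_zero
  have hk2 : (N : ℂ) + 2 ≠ 0 := by exact_mod_cast (N + 1).succ_ne_zero
  have hsplit : ((N + 1 + 2).factorial : ℂ) * ∑ k ∈ Finset.range (N + 1),
        (-1 : ℂ) ^ k * J k / ((k.factorial : ℂ) * (((N + 1 + 2 : ℕ) : ℂ) - (k : ℂ))) *
          (z ^ k / z ^ (N + 1 + 2)) -
      ((N + 1).factorial : ℂ) * ∑ k ∈ Finset.range (N + 1),
        (-1 : ℂ) ^ k * J k / ((k.factorial : ℂ) * (((N + 1 : ℕ) : ℂ) - (k : ℂ))) *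
          (z ^ k / z ^ (N + 1)) -
      (((N + 1 : ℕ) : ℂ) + 1) / z * (((N + 1 + 1).factorial : ℂ) * ∑ k ∈ Finset.range (N + 1),
        (-1 : ℂ) ^ k * J k / ((k.factorial : ℂ) * (((N + 1 + 1 : ℕ) : ℂ) - (k : ℂ))) *
          (z ^ k / z ^ (N + 1 + 1))) =
      ((N + 1).factorial : ℂ) * ((-1) ^ N * N / (N.factorial * 2) * J (N + 1) * z ^ N / z ^ (N + 2)
        - (-1) ^ N / (N.factorial) * J N * z ^ N / z ^ (N + 1)) := by
    have h' : ((-1 : ℂ)) ^ N * N / (N.factorial * (((N + 1 : ℕ) : ℂ) + 1 - N)) * J (N + 1) * z ^ N /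
        z ^ (N + 1 + 1) - (-1) ^ N / (N.factorial * (((N + 1 : ℕ) : ℂ) - N)) * J N * z ^ N /
        z ^ (N + 1) = (-1) ^ N * N / (N.factorial * 2) * J (N + 1) * z ^ N / z ^ (N + 2)
        - (-1) ^ N / (N.factorial) * J N * z ^ N / z ^ (N + 1) := by
      push_cast
      rw [show (N : ℂ) + 1 + 1 - N = 2 by ring, show (N : ℂ) + 1 - N = 1 by ring, mul_one]
    rw [← h', ← h]
    simp only [Finset.mul_sum]
    rw [← Finset.sum_sub_distrib, ← Finset.sum_sub_distrib]
    refine Finset.sum_congr rfl fun k _ => ?_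
    simp only [Nat.factorial_succ, pow_succ, Nat.cast_mul, Nat.cast_add, Nat.cast_one,
      Nat.cast_ofNat, div_eq_mul_inv, mul_inv]
    ring
  rw [Finset.sum_range_succ _ (N + 1 + 1), Finset.sum_range_succ _ (N + 1),
    Finset.sum_range_succ _ (N + 1)]
  have e1 : ((N + 1 + 2 : ℕ) : ℂ) - ((N + 1 : ℕ) : ℂ) = 2 := by push_cast; ring
  have e2 : ((N + 1 + 2 : ℕ) : ℂ) - ((N + 1 + 1 : ℕ) : ℂ) = 1 := by push_cast; ring
  have e3 : ((N + 1 + 1 : ℕ) : ℂ) - ((N + 1 : ℕ) : ℂ) = 1 := by push_cast; ring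
  rw [e1, e2, e3]
  have hp : J (N + 1 + 1) = J N - (N + 1) / z * J (N + 1) := by linear_combination -hJ N
  have hrem : ((N + 1).factorial : ℂ) *
        ((-1) ^ N * N / (N.factorial * 2) * J (N + 1) * z ^ N / z ^ (N + 2)
        - (-1) ^ N / (N.factorial) * J N * z ^ N / z ^ (N + 1)) +
      ((N + 1 + 2).factorial : ℂ) *
        ((-1) ^ (N + 1) * J (N + 1) / ((N + 1).factorial * 2) * (z ^ (N + 1) / z ^ (N + 1 + 2)) +
        (-1) ^ (N + 1 + 1) * J (N + 1 + 1) / ((N + 1 + 1).factorial * 1) *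
          (z ^ (N + 1 + 1) / z ^ (N + 1 + 2))) -
      (((N + 1 : ℕ) : ℂ) + 1) / z * ((N + 1 + 1).factorial *
        ((-1) ^ (N + 1) * J (N + 1) / ((N + 1).factorial * 1) *
          (z ^ (N + 1) / z ^ (N + 1 + 1)))) +
      (-1) ^ (N + 1) * (2 / z) * J (N + 1 + 1) = 0 := by
    rw [hp]
    simp only [Nat.factorial_succ]
    push_cast
    rw [show (N : ℂ) + 1 + 1 = N + 2 by ring]
    field_simp
    ring
  linear_combination hsplit + hrem

/-! ### Sum and difference of the order derivatives at ±m -/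

/-- `K_m(t)` in terms of the order derivatives of `I_ν(t)` at `±m`. -/
lemma modifiedBesselK_nat (m : ℕ) {t : ℂ} (ht : t ≠ 0) :
    modifiedBesselK (m : ℂ) t = -(-1) ^ m / 2 * (deriv (fun μ => modifiedBesselI μ t) m +
      deriv (fun μ => modifiedBesselI μ t) (-m)) := by
  have hd := differentiable_modifiedBesselI ht
  have hpi : (Real.pi : ℂ) ≠ 0 := by exact_mod_cast Real.pi_ne_zero
  rw [modifiedBesselK, if_pos ⟨(m : ℤ), by simp⟩]
  apply Tendsto.limUnder_eq
  have hcos : Complex.cos ((Real.pi : ℂ) * m) = (-1) ^ m := by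
    rw [mul_comm]; exact_mod_cast congrArg ((↑) : ℝ → ℂ) (Real.cos_nat_mul_pi m)
  have hsin : Complex.sin ((Real.pi : ℂ) * m) = 0 := by
    rw [mul_comm]; exact Complex.sin_nat_mul_pi m
  have hden : HasDerivAt (fun μ : ℂ => Complex.sin ((Real.pi : ℂ) * μ))
      ((-1) ^ m * Real.pi) (m : ℂ) := by
    have := ((hasDerivAt_id (m : ℂ)).const_mul (Real.pi : ℂ)).csin
    simpa [hcos] using this
  have hnum : HasDerivAt (fun μ : ℂ => (Real.pi : ℂ) / 2 *
      (modifiedBesselI (-μ) t - modifiedBesselI μ t))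
      ((Real.pi : ℂ) / 2 * (-deriv (fun μ => modifiedBesselI μ t) (-m) -
        deriv (fun μ => modifiedBesselI μ t) m)) (m : ℂ) := by
    have h1 := ((hd (-(m : ℂ))).hasDerivAt.scomp (m : ℂ) (hasDerivAt_neg (m : ℂ)))
    have h2 := (h1.sub (hd (m : ℂ)).hasDerivAt).const_mul ((Real.pi : ℂ) / 2)
    simpa using h2
  have hne : ((-1 : ℂ)) ^ m * Real.pi ≠ 0 := mul_ne_zero (by simp) hpi
  -- Numerator and denominator vanish at m, so the quotient equals the ratio of their slopes there.
  have hlim := (hasDerivAt_iff_tendsto_slope.1 hnum).div (hasDerivAt_iff_tendsto_slope.1 hden) hne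
  have hval : (Real.pi : ℂ) / 2 * (-deriv (fun μ => modifiedBesselI μ t) (-m) -
        deriv (fun μ => modifiedBesselI μ t) m) / ((-1) ^ m * Real.pi) =
      -(-1) ^ m / 2 * (deriv (fun μ => modifiedBesselI μ t) m +
        deriv (fun μ => modifiedBesselI μ t) (-m)) := by
    have hsq : ((-1 : ℂ) ^ m) * (-1) ^ m = 1 := by rw [← mul_pow]; simp
    rw [div_eq_iff hne]
    linear_combination (Real.pi / 2 * (deriv (fun μ => modifiedBesselI μ t) m +
        deriv (fun μ => modifiedBesselI μ t) (-m))) * hsq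
  rw [hval] at hlim
  refine hlim.congr' ?_
  filter_upwards [self_mem_nhdsWithin] with μ hμ
  have hμ' : μ - m ≠ 0 := sub_ne_zero.2 hμ
  simp only [Pi.div_apply, slope_def_field, hsin, modifiedBesselI_neg_nat m ht, sub_self, mul_zero,
    sub_zero, modifiedBesselKQuot]
  exact div_div_div_cancel_right₀ hμ' _ _

/-- The difference of the order derivatives of `I_ν(t)` at `m` and at `-m`. -/
lemma deriv_modifiedBesselI_nat_sub_neg (m : ℕ) {t : ℂ} (ht : t ≠ 0) :
    deriv (fun μ => modifiedBesselI μ t) m - deriv (fun μ => modifiedBesselI μ t) (-m) =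
      (-1) ^ m * (m.factorial * orderSum (fun k => modifiedBesselI k t) (t / 2) m) := by
  have h2 : t / 2 ≠ 0 := div_ne_zero ht two_ne_zero
  induction m using Nat.twoStepInduction with
  | zero => simp [orderSum]
  | one =>
    have h := deriv_modifiedBesselI_sub 0 ht
    simp only [zero_sub, zero_add, zero_div, zero_mul, add_zero] at h
    simp only [orderSum, Finset.sum_range_one]
    simp
    simp at h
    linear_combination -h
  | more n ih0 ih1 =>
    rw [orderSum_recurrence h2 (fun k => by
      have h := modifiedBesselI_sub_modifiedBesselI ((k : ℂ) + 1) ht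
      rw [show (k : ℂ) + 1 - 1 = k by ring, show (k : ℂ) + 1 + 1 = k + 2 by ring] at h
      push_cast
      exact h) n]
    -- Adding the differentiated recurrences at n + 1 and -(n + 1) yields one for the difference;
    -- its I-terms add up because I_{-(n+1)} = I_{n+1}.
    have h := deriv_modifiedBesselI_sub ((n : ℂ) + 1) ht
    have h' := deriv_modifiedBesselI_sub (-((n : ℂ) + 1)) ht
    have hs := modifiedBesselI_neg_nat (n + 1) ht
    push_cast at ih1 hs ⊢
    rw [show (n : ℂ) + 1 - 1 = n by ring, show (n : ℂ) + 1 + 1 = n + 2 by ring] at h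
    rw [show -((n : ℂ) + 1) - 1 = -(n + 2) by ring, show -((n : ℂ) + 1) + 1 = -n by ring,
      hs] at h'
    rw [pow_succ] at ih1
    have hsq : ((-1 : ℂ) ^ n) * (-1) ^ n = 1 := by rw [← mul_pow]; simp
    have e : ((-1 : ℂ)) ^ (n + 2) = (-1) ^ n := by rw [pow_add]; simp
    rw [e]
    linear_combination -h - h' + ih0 - ((n : ℂ) + 1) / (t / 2) * ih1 +
      2 / (t / 2) * modifiedBesselI ((n : ℂ) + 1) t * hsq

end ModifiedBessel


open ModifiedBessel

theorem mainTheorem10 (m : ℕ) (t : ℂ) (ht : t ≠ 0) :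
    HasDerivAt (fun ν : ℂ => modifiedBesselI ν t)
      ((-1 : ℂ) ^ m * (-modifiedBesselK (m : ℂ) t +
        (m.factorial : ℂ) / 2 * ∑ k ∈ Finset.range m,
          (-1 : ℂ) ^ k * modifiedBesselI (k : ℂ) t / ((k.factorial : ℂ) * ((m : ℂ) - (k : ℂ))) *
            (t / 2) ^ ((k : ℤ) - (m : ℤ))))
      (m : ℂ) ∧
    HasDerivAt (fun ν : ℂ => modifiedBesselI ν t)
      ((-1 : ℂ) ^ m * (-modifiedBesselK (m : ℂ) t -
        (m.factorial : ℂ) / 2 * ∑ k ∈ Finset.range m,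
          (-1 : ℂ) ^ k * modifiedBesselI (k : ℂ) t / ((k.factorial : ℂ) * ((m : ℂ) - (k : ℂ))) *
            (t / 2) ^ ((k : ℤ) - (m : ℤ))))
      (-(m : ℂ)) := by
  have hd := differentiable_modifiedBesselI ht
  have hK := modifiedBesselK_nat m ht
  have hD := deriv_modifiedBesselI_nat_sub_neg m ht
  have hsq : ((-1 : ℂ) ^ m) * (-1) ^ m = 1 := by rw [← mul_pow]; simp
  simp only [orderSum] at hD
  generalize ∑ k ∈ Finset.range m, (-1 : ℂ) ^ k * modifiedBesselI (k : ℂ) t /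
    ((k.factorial : ℂ) * ((m : ℂ) - (k : ℂ))) * (t / 2) ^ ((k : ℤ) - (m : ℤ)) = S at hD ⊢
  rw [hK]
  generalize hA : deriv (fun μ => modifiedBesselI μ t) (m : ℂ) = A at hD ⊢
  generalize hB : deriv (fun μ => modifiedBesselI μ t) (-(m : ℂ)) = B at hD ⊢
  constructor
  · refine (hd (m : ℂ)).hasDerivAt.congr_deriv ?_
    rw [hA]
    linear_combination hD / 2 - (A + B) / 2 * hsq
  · refine (hd (-(m : ℂ))).hasDerivAt.congr_deriv ?_
    rw [hB]
    linear_combination -hD / 2 - (A + B) / 2 * hsq
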